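/- Let $X$ be a nonempty compact metric space with distance $d$ and $T\colon X\to X$ a homeomorphism such that $(X,T)$ is minimal (every orbit $\{T^nx : n\in\mathbb Z\}$ is dense in $X$) and distal ($\inf_{n\in\mathbb Z} d(T^nx,T^ny)>0$ for all $x\ne y$ in $X$). Let $\mathcal P\subset X^4$ be the closure of $$\{(x,T^mx,T^nx,T^{m+n}x) : x\in X,\ m,n\in\mathbb Z\}$$ and let $\mathcal Q\subset X^8$ be the closure of $$\{(x,T^mx,T^nx,T^{m+n}x,T^px,T^{m+p}x,T^{n+p}x,T^{m+n+p}x) : x\in X,\ m,n,p\in\mathbb Z\}.$$ Number the vertices of the cube $\{0,1\}^3$ from $0$ to $7$ by binary expansion, and identify $X^8$ with $X^4\times X^4$. Then the closed sets $(\mathcal P,\mathcal Q)$ form a parallelepiped structure on $X$ in the sense of Host and Kra, that is: 1. (Parallelogram structure.) The relation $(x_0,x_1)\sim(x_2,x_3)\iff(x_0,x_1,x_2,x_3)\in\mathcal P$ is an equivalence relation on $X^2$; if $(x_0,x_1,x_2,x_3)\in\mathcal P$ then $(x_0,x_2,x_1,x_3)\in\mathcal P$; and for all $x_0,x_1,x_2\in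 X$ there is $x_3\in X$ with $(x_0,x_1,x_2,x_3)\in\mathcal P$. 2. (Faces.) If $(x_0,\dots,x_7)\in\mathcal Q$, then each of its six faces $(x_0,x_1,x_2,x_3)$, $(x_4,x_5,x_6,x_7)$, $(x_0,x_1,x_4,x_5)$, $(x_2,x_3,x_6,x_7)$, $(x_0,x_2,x_4,x_6)$, $(x_1,x_3,x_5,x_7)$ belongs to $\mathcal P$. 3. (Symmetry.) $\mathcal Q$ is invariant under the permutations of coordinates induced by the Euclidean isometries of the cube. 4. (Equivalence relation.) The relation $\mathbf u\approx\mathbf v\iff(\mathbf u,\mathbf v)\in\mathcal Q$ is an equivalence relation on $\mathcal P$; in particular $\mathcal Q$ is transitive: if $\mathbf u,\mathbf v,\mathbf w\in\mathcal P$ and $(\mathbf u,\mathbf v),(\mathbf v,\mathbf w)\in\mathcal Q$, then $(\mathbf u,\mathbf w)\in\mathcal Q$. 5. (Closing property.) If $(x_0,x_1,x_2,x_3)$, $(x_0,x_1,x_4,x_5)$ and $(x_0,x_2,x_4,x_6)$ belong to $\mathcal P$, then there is $x_7\in X$ with $(x_0,\dots,x_7)\in\mathcal Q$. Moreover, for every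 $(x_0,\dots,x_6)\in X^7$ the following are equivalent: (a) $(x_0,x_1,x_2,x_3)$, $(x_0,x_1,x_4,x_5)$ and $(x_0,x_2,x_4,x_6)$ belong to $\mathcal P$; (b) there is $x_7\in X$ with $(x_0,\dots,x_6,x_7)\in\mathcal Q$; (c) there are sequences of integers $(m_i)$, $(n_i)$, $(p_i)$ with $T^{m_i}x_0\to x_1$, $T^{n_i}x_0\to x_2$, $T^{m_i+n_i}x_0\to x_3$, $T^{p_i}x_0\to x_4$, $T^{m_i+p_i}x_0\to x_5$ and $T^{n_i+p_i}x_0\to x_6$. -/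

import Mathlib

open Filter Topology

namespace DynPara

/-- The system `(X, T)` is minimal: every orbit `{T ^ n x : n ∈ ℤ}` is dense. -/
def IsMinimal {X : Type*} [TopologicalSpace X] (T : X ≃ₜ X) : Prop :=
  ∀ x : X, Dense (Set.range fun n : ℤ => (T ^ n) x)

/-- The system `(X, T)` is distal: `inf_{n ∈ ℤ} d(T ^ n x, T ^ n y) > 0` whenever `x ≠ y`. -/
def IsDistal {X : Type*} [MetricSpace X] (T : X ≃ₜ X) : Prop :=
  ∀ x y : X, x ≠ y → 0 < ⨅ n : ℤ, dist ((T ^ n) x) ((T ^ n) y)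

/-- The set of dynamical parallelograms, a subset of `X ^ 4`. -/
def parallelograms {X : Type*} [TopologicalSpace X] (T : X ≃ₜ X) : Set (Fin 4 → X) :=
  closure {y | ∃ (x : X) (m n : ℤ), y = ![x, (T ^ m) x, (T ^ n) x, (T ^ (m + n)) x]}

/-- The set of dynamical parallelepipeds, a subset of `X ^ 8`. -/
def parallelepipeds {X : Type*} [TopologicalSpace X] (T : X ≃ₜ X) : Set (Fin 8 → X) :=
  closure {y | ∃ (x : X) (m n p : ℤ),
    y = ![x, (T ^ m) x, (T ^ n) x, (T ^ (m + n)) x,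
      (T ^ p) x, (T ^ (m + p)) x, (T ^ (n + p)) x, (T ^ (m + n + p)) x]}

/-- The identification of `X ^ 4 × X ^ 4` with `X ^ 8`. -/
def pair {X : Type*} (u v : Fin 4 → X) : Fin 8 → X :=
  ![u 0, u 1, u 2, u 3, v 0, v 1, v 2, v 3]

/-- The vertices of the cube `{0,1} ^ 3` are numbered `0, …, 7` by their binary expansions;
this is the vertex of `{0,1} ^ 3` with number `i`. -/
def vertex (i : Fin 8) : Fin 3 → Bool :=
  fun k => (i : ℕ).testBit k

/-- The six two-dimensional faces of the cube, each as the increasing list of its vertices. -/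
def face : Fin 6 → Fin 4 → Fin 8 :=
  ![![0, 1, 2, 3], ![4, 5, 6, 7], ![0, 1, 4, 5], ![2, 3, 6, 7], ![0, 2, 4, 6], ![1, 3, 5, 7]]

/-- Euclidean permutations of the cube: the permutations of its vertices that are isometries.
The squared Euclidean distance of two vertices is their Hamming distance. -/
def IsEuclidean (σ : Equiv.Perm (Fin 8)) : Prop :=
  ∀ i j : Fin 8,
    hammingDist (vertex (σ i)) (vertex (σ j)) = hammingDist (vertex i) (vertex j)

/-- (Weak) parallelogram structures on `X` in the sense of Host and Kra. -/
structure IsParallelogramStructure {X : Type*} (P : Set (Fin 4 → X)) : Prop where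
  /-- The relation `(x₀, x₁) ∼ (x₂, x₃)` on `X ^ 2`. -/
  equivalence : Equivalence fun a b : X × X => ![a.1, a.2, b.1, b.2] ∈ P
  symmetry : ∀ x₀ x₁ x₂ x₃ : X, ![x₀, x₁, x₂, x₃] ∈ P → ![x₀, x₂, x₁, x₃] ∈ P
  closing : ∀ x₀ x₁ x₂ : X, ∃ x₃ : X, ![x₀, x₁, x₂, x₃] ∈ P

/-- (Weak) parallelepiped structures on `X` in the sense of Host and Kra. -/
structure IsParallelepipedStructure {X : Type*} (P : Set (Fin 4 → X)) (Q : Set (Fin 8 → X)) :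
    Prop where
  parallelogram : IsParallelogramStructure P
  face_mem : ∀ x ∈ Q, ∀ f : Fin 6, x ∘ face f ∈ P
  symmetry : ∀ x ∈ Q, ∀ σ : Equiv.Perm (Fin 8), IsEuclidean σ → x ∘ σ ∈ Q
  /-- The relation `u ≈ v` on `P`. -/
  equivalence : Equivalence fun u v : P => pair (u : Fin 4 → X) (v : Fin 4 → X) ∈ Q
  closing : ∀ x₀ x₁ x₂ x₃ x₄ x₅ x₆ : X,
    ![x₀, x₁, x₂, x₃] ∈ P → ![x₀, x₁, x₄, x₅] ∈ P → ![x₀, x₂, x₄, x₆] ∈ P →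
      ∃ x₇ : X, ![x₀, x₁, x₂, x₃, x₄, x₅, x₆, x₇] ∈ Q

end DynPara

/-! Everything is phrased through orbit closures `Reach T A x y` for a group `A` of exponents acting
coordinatewise on a power of `X`. By minimality, the parallelograms and the parallelepipeds are each
the orbit closure of any constant tuple, under groups cut out by linear equations. By distality the
Ellis semigroup is a group, so `Reach` is symmetric (`Reach.symm`). A tuple can thus be collapsed to
a simpler one and the move reversed; `Reach.extend` carries a move of some coordinates to all the
others by compactness. Faces and symmetries follow from the linear equations, transitivity from
collapsing.

The closing property needs more: a parallelogram must be a limit of parallelograms with exactly its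
own first vertex (`reach_corner_of_mem`). Collapsing reduces this to `![x, x, x, y]`. The pairs `(a,
b)` for which `![x, a, x, b]` is a limit of corners at `x` form, once symmetrised, a closed
invariant equivalence relation. Modulo this relation the limit of `T ^ n x` determines that of `T ^
n a`, so by Baire's theorem the quotient is equicontinuous. There, `z` close to `T ^ m z` forces `T
^ n z` close to `T ^ (m + n) z`, hence `x` and `y` are equivalent. Three parallelograms at a vertex
are then collapsed one after another (`reach_puncture`), and compactness supplies the eighth vertex.
-/

namespace DynPara

/-! ### Orbit closures and the Ellis group -/

section Reach

variable {X I J : Type*}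

/-- The action of `I → ℤ` on `I → X` by powers of `T` in each coordinate. -/
def act [TopologicalSpace X] (T : X ≃ₜ X) (a : I → ℤ) (x : I → X) : I → X :=
  fun i => (T ^ a i) (x i)

/-- `y` belongs to the closure of the orbit of `x` under the group of exponents `A`. -/
def Reach [TopologicalSpace X] (T : X ≃ₜ X) (A : AddSubgroup (I → ℤ)) (x y : I → X) : Prop :=
  y ∈ closure ((fun a => act T a x) '' (A : Set (I → ℤ)))

section Topological

variable [TopologicalSpace X] {T : X ≃ₜ X} {A : AddSubgroup (I → ℤ)} {B : AddSubgroup (J → ℤ)}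

theorem act_zero (x : I → X) : act T 0 x = x := by
  funext i; simp [act]

theorem act_add (a b : I → ℤ) (x : I → X) : act T (a + b) x = act T a (act T b x) := by
  funext i; simp [act, zpow_add]

theorem continuous_act (a : I → ℤ) : Continuous (act T a) :=
  continuous_pi fun i => (T ^ a i).continuous.comp (continuous_apply i)

theorem Reach.of_act {a : I → ℤ} (ha : a ∈ A) (x : I → X) : Reach T A x (act T a x) :=
  subset_closure ⟨a, ha, rfl⟩

theorem Reach.refl (x : I → X) : Reach T A x x := by
  simpa [act_zero] using Reach.of_act (T := T) A.zero_mem x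

theorem isClosed_setOf_reach (x : I → X) : IsClosed {y | Reach T A x y} := isClosed_closure

theorem Reach.mem_of_isClosed {x y : I → X} (h : Reach T A x y) {s : Set (I → X)}
    (hs : IsClosed s) (hx : ∀ a ∈ A, act T a x ∈ s) : y ∈ s :=
  closure_minimal (by rintro _ ⟨a, ha, rfl⟩; exact hx a ha) hs h

theorem Reach.act_right {x y : I → X} (h : Reach T A x y) {a : I → ℤ} (ha : a ∈ A) :
    Reach T A x (act T a y) := by
  refine h.mem_of_isClosed (s := act T a ⁻¹' {y | Reach T A x y})
    ((isClosed_setOf_reach x).preimage (continuous_act a)) fun b hb => ?_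
  change Reach T A x (act T a (act T b x))
  rw [← act_add]
  exact Reach.of_act (A.add_mem ha hb) x

theorem Reach.trans {x y z : I → X} (h : Reach T A x y) (h' : Reach T A y z) :
    Reach T A x z :=
  h'.mem_of_isClosed (isClosed_setOf_reach x) fun _ ha => h.act_right ha

theorem Reach.proj {x y : I → X} (h : Reach T A x y) (f : J → I)
    (hf : ∀ a ∈ A, a ∘ f ∈ B) : Reach T B (x ∘ f) (y ∘ f) :=
  h.mem_of_isClosed (s := (fun y => y ∘ f) ⁻¹' {y | Reach T B (x ∘ f) y})
    ((isClosed_setOf_reach _).preimage (by fun_prop)) fun a ha => Reach.of_act (hf a ha) (x ∘ f)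

theorem Reach.mono {A' : AddSubgroup (I → ℤ)} {x y : I → X} (h : Reach T A x y) (hA : A ≤ A') :
    Reach T A' x y :=
  h.proj (B := A') id fun _ ha => hA ha

/-- A limit of the orbit of `w` lifts, by compactness, to a limit of the orbit of `z` whose
exponents are read off from those of `w` (with `none` standing for the exponent zero). -/
theorem Reach.extend [CompactSpace X] [T2Space X] {w w' : J → X} (h : Reach T B w w')
    (f : I → Option J) (hf : ∀ b ∈ B, (fun i => (f i).elim 0 b) ∈ A) (z : I → X) :
    ∃ z', Reach T A z z' ∧ (∀ i j, f i = some j → z i = w j → z' i = w' j) ∧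
      ∀ i, f i = none → z' i = z i := by
  -- The joint orbit closure of `(z, w)` is compact, so its second projection is closed and contains
  -- `w'`.
  let g : (J → ℤ) → (I → X) × (J → X) := fun b => (act T (fun i => (f i).elim 0 b) z, act T b w)
  have hc : IsClosed (Prod.snd '' closure (g '' B)) :=
    (isClosed_closure.isCompact.image continuous_snd).isClosed
  obtain ⟨⟨z', _⟩, hz, rfl⟩ := h.mem_of_isClosed hc fun b hb =>
    ⟨g b, subset_closure ⟨b, hb, rfl⟩, rfl⟩
  have key : ∀ s : Set ((I → X) × (J → X)), IsClosed s → (∀ b ∈ B, g b ∈ s) → (z', _) ∈ s :=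
    fun s hs hg => closure_minimal (by rintro _ ⟨b, hb, rfl⟩; exact hg b hb) hs hz
  refine ⟨z', ?_, fun i j hij hzw => ?_, fun i hi => ?_⟩
  · exact key (Prod.fst ⁻¹' {y | Reach T A z y})
      ((isClosed_setOf_reach z).preimage continuous_fst) fun b hb => Reach.of_act (hf b hb) z
  · refine key {p | p.1 i = p.2 j} (isClosed_eq (by fun_prop) (by fun_prop)) fun b _ => ?_
    simp [g, act, hij, hzw]
  · refine key {p | p.1 i = z i} (isClosed_eq (by fun_prop) (by fun_prop)) fun b _ => ?_
    simp [g, act, hi]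

theorem IsMinimal.reach_const (hmin : IsMinimal T)
    (hA : ∀ n : ℤ, (fun _ => n) ∈ A) (x y : X) : Reach T A (fun _ => x) (fun _ => y) := by
  have : y ∈ (fun y : X => (fun _ : I => y)) ⁻¹' {y | Reach T A (fun _ => x) y} := by
    refine closure_minimal ?_ ((isClosed_setOf_reach (T := T) (A := A) fun _ => x).preimage
      (by fun_prop)) (hmin x y)
    rintro _ ⟨n, rfl⟩
    exact Reach.of_act (hA n) fun _ => x
  exact this

end Topological

variable [MetricSpace X] [CompactSpace X] {T : X ≃ₜ X} {A : AddSubgroup (I → ℤ)}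

/-- Orbit closures of a distal system are minimal: the Ellis semigroup is a group. -/
theorem Reach.symm (hdist : IsDistal T) {x y : I → X} (h : Reach T A x y) : Reach T A y x := by
  let : TopologicalSpace (Function.End (I → X)) :=
    inferInstanceAs (TopologicalSpace ((I → X) → (I → X)))
  have : CompactSpace (Function.End (I → X)) :=
    inferInstanceAs (CompactSpace ((I → X) → (I → X)))
  have : T2Space (Function.End (I → X)) :=
    inferInstanceAs (T2Space ((I → X) → (I → X)))
  have hev : ∀ z : I → X, Continuous fun p : Function.End (I → X) => p z :=
    fun z => continuous_apply (A := fun _ : I → X => I → X) z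
  have hmul : ∀ r : Function.End (I → X), Continuous (· * r) :=
    fun r => continuous_pi (A := fun _ : I → X => I → X) fun z => hev (r z)
  let g : (I → ℤ) → Function.End (I → X) := fun a => act T a
  let G : Set (Function.End (I → X)) := g '' (A : Set (I → ℤ))
  have hind : ∀ s : Set (Function.End (I → X)), IsClosed s → (∀ a ∈ A, g a ∈ s) →
      ∀ p ∈ closure G, p ∈ s :=
    fun s hs ha p hp => closure_minimal (by rintro _ ⟨a, h, rfl⟩; exact ha a h) hs hp
  have hGmul : ∀ p ∈ closure G, ∀ q ∈ closure G, p * q ∈ closure G := by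
    have h₁ : ∀ a ∈ A, ∀ q ∈ closure G, g a * q ∈ closure G := by
      intro a ha
      refine hind ((fun q => g a * q) ⁻¹' closure G) (isClosed_closure.preimage ?_) fun b hb => ?_
      · exact continuous_pi (A := fun _ : I → X => I → X)
          fun z => (continuous_act a).comp (hev z)
      · exact subset_closure ⟨a + b, A.add_mem ha hb, funext fun z => act_add a b z⟩
    intro p hp q hq
    exact hind ((· * q) ⁻¹' closure G) (isClosed_closure.preimage (hmul q))
      (fun a ha => h₁ a ha q hq) p hp
  have hidem : ∀ u ∈ closure G, u * u = u → u = 1 := by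
    intro u hu huu
    funext z
    funext i
    by_contra hne
    -- An idempotent `u` sends `u z` and `z` to the same point. But elements of the closure of `G`
    -- keep their `i`-th coordinates at least the distal infimum apart, a bound that passes to
    -- pointwise limits.
    have hpos := hdist _ _ hne
    have := hind {p | (⨅ n : ℤ, dist ((T ^ n) (u z i)) ((T ^ n) (z i))) ≤
      dist (p (u z) i) (p z i)} (isClosed_le continuous_const (((continuous_apply i).comp
        (hev _)).dist ((continuous_apply i).comp (hev _))))
      (fun a _ => ciInf_le (f := fun n : ℤ => dist ((T ^ n) (u z i)) ((T ^ n) (z i)))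
        ⟨0, by rintro _ ⟨n, rfl⟩; exact dist_nonneg⟩ (a i)) u hu
    have huz : u (u z) = u z := congrFun huu z
    simp only [Set.mem_ofPred_eq, huz, dist_self] at this
    exact absurd hpos (not_lt.2 this)
  have hcl : ∀ z : I → X, ∀ p ∈ closure G, Reach T A z (p z) := fun z =>
    hind {p | Reach T A z (p z)} ((isClosed_setOf_reach z).preimage (hev z))
      fun a ha => Reach.of_act ha z
  obtain ⟨p, hp, rfl⟩ : ∃ p ∈ closure G, p x = y :=
    h.mem_of_isClosed (s := (fun p : Function.End (I → X) => p x) '' closure G)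
      (isClosed_closure.isCompact.image (hev x)).isClosed
      fun a ha => ⟨g a, subset_closure ⟨a, ha, rfl⟩, rfl⟩
  -- The left ideal generated by `p` is a compact semigroup with continuous right multiplications.
  -- Its idempotent `q * p` must be `1`, so `q` brings `p x` back to `x`.
  obtain ⟨_, ⟨q, hq, rfl⟩, hu⟩ := exists_idempotent_in_compact_subsemigroup hmul
    ((· * p) '' closure G) ⟨_, p, hp, rfl⟩ (isClosed_closure.isCompact.image (hmul p)) (by
      rintro _ ⟨q, hq, rfl⟩ _ ⟨r, hr, rfl⟩
      exact ⟨q * p * r, hGmul _ (hGmul _ hq _ hp) _ hr, rfl⟩)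
  have hqp : q (p x) = x := congrFun (hidem _ (hGmul _ hq _ hp) hu) x
  simpa only [hqp] using hcl (p x) q hq

end Reach

/-! ### Invariant functions separating equivalence classes -/

section Separation

/-- Points that are inequivalent for a closed equivalence relation on a compact Hausdorff space
are separated by an invariant continuous function. -/
theorem exists_continuous_invariant_ne {X : Type*} [TopologicalSpace X] [CompactSpace X]
    [T2Space X] (s : Setoid X) (hs : IsClosed {p : X × X | s p.1 p.2}) {x y : X}
    (hxy : ¬ s x y) : ∃ h : X → ℝ, Continuous h ∧ (∀ a b, s a b → h a = h b) ∧ h x ≠ h y := by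
  have hmk : Continuous (Quotient.mk s) := continuous_quotient_mk'
  have hclosed : IsClosedMap (Quotient.mk s) := by
    intro C hC
    rw [← isQuotientMap_quotient_mk'.isClosed_preimage]
    -- The saturation of a closed set is the projection of a compact set, hence closed.
    have : Quotient.mk s ⁻¹' (Quotient.mk s '' C) =
        Prod.snd '' ({p : X × X | s p.1 p.2} ∩ Prod.fst ⁻¹' C) := by
      ext b
      constructor
      · rintro ⟨a, ha, hab⟩
        exact ⟨(a, b), ⟨Quotient.exact hab, ha⟩, rfl⟩
      · rintro ⟨⟨a, b⟩, ⟨hab, ha⟩, rfl⟩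
        exact ⟨a, ha, Quotient.sound hab⟩
    change IsClosed (Quotient.mk s ⁻¹' (Quotient.mk s '' C))
    rw [this]
    exact ((hs.inter (hC.preimage continuous_fst)).isCompact.image continuous_snd).isClosed
  have : T1Space (Quotient s) := ⟨fun q => by
    obtain ⟨a, rfl⟩ := Quotient.exists_rep q
    simpa using hclosed _ (isClosed_singleton (x := a))⟩
  have : NormalSpace (Quotient s) := ⟨fun C D hC hD hCD => by
    obtain ⟨U, V, hU, hV, hCU, hDV, hUV⟩ := normal_separation (hC.preimage hmk) (hD.preimage hmk)
      (hCD.preimage (Quotient.mk s))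
    -- These are the sets of classes entirely contained in `U`, respectively `V`.
    refine ⟨(Quotient.mk s '' Uᶜ)ᶜ, (Quotient.mk s '' Vᶜ)ᶜ,
      (hclosed _ hU.isClosed_compl).isOpen_compl, (hclosed _ hV.isClosed_compl).isOpen_compl,
      ?_, ?_, ?_⟩
    · rintro _ hq ⟨a, ha, rfl⟩
      exact ha (hCU hq)
    · rintro _ hq ⟨a, ha, rfl⟩
      exact ha (hDV hq)
    · rw [Set.disjoint_left]
      intro q hqU hqV
      obtain ⟨a, rfl⟩ := Quotient.exists_rep q
      have haU : a ∈ U := by_contra fun h => hqU ⟨a, h, rfl⟩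
      have haV : a ∈ V := by_contra fun h => hqV ⟨a, h, rfl⟩
      exact Set.disjoint_left.1 hUV haU haV⟩
  obtain ⟨g, hg0, hg1, -⟩ := exists_continuous_zero_one_of_isClosed
    (isClosed_singleton (x := Quotient.mk s x)) (isClosed_singleton (x := Quotient.mk s y))
    (by simpa using fun h => hxy (Quotient.exact h))
  refine ⟨fun a => g (Quotient.mk s a), g.continuous.comp hmk,
    fun a b hab => congrArg g (Quotient.sound hab), ?_⟩
  have h0 : g (Quotient.mk s x) = 0 := hg0 rfl
  have h1 : g (Quotient.mk s y) = 1 := hg1 rfl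
  simp [h0, h1]

end Separation

/-! ### Groups of exponents -/

section Exponents

/-- The exponents `(k, k + m, k + n, k + m + n)`. -/
def parallelogramExponents : AddSubgroup (Fin 4 → ℤ) where
  carrier := {a | a 0 + a 3 = a 1 + a 2}
  zero_mem' := by simp
  add_mem' {a b} ha hb := by simp only [Set.mem_ofPred_eq, Pi.add_apply] at *; omega
  neg_mem' {a} ha := by simp only [Set.mem_ofPred_eq, Pi.neg_apply] at *; omega

/-- The exponents `(0, m, n, m + n)`. -/
def cornerExponents : AddSubgroup (Fin 4 → ℤ) where
  carrier := {a | a 0 = 0 ∧ a 3 = a 1 + a 2}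
  zero_mem' := by simp
  add_mem' {a b} ha hb := by simp only [Set.mem_ofPred_eq, Pi.add_apply] at *; omega
  neg_mem' {a} ha := by simp only [Set.mem_ofPred_eq, Pi.neg_apply] at *; omega

/-- The exponents of a parallelepiped, given by the equations of four of its faces. -/
def parallelepipedExponents : AddSubgroup (Fin 8 → ℤ) where
  carrier := {a | a 0 + a 3 = a 1 + a 2 ∧ a 4 + a 7 = a 5 + a 6 ∧ a 0 + a 5 = a 1 + a 4 ∧
    a 0 + a 6 = a 2 + a 4}
  zero_mem' := by simp
  add_mem' {a b} ha hb := by simp only [Set.mem_ofPred_eq, Pi.add_apply] at *; omega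
  neg_mem' {a} ha := by simp only [Set.mem_ofPred_eq, Pi.neg_apply] at *; omega

/-- Constant exponents. -/
def diagonalExponents (I : Type*) : AddSubgroup (I → ℤ) where
  carrier := {a | ∀ i j, a i = a j}
  zero_mem' := by simp
  add_mem' {a b} ha hb i j := by simp [ha i j, hb i j]
  neg_mem' {a} ha i j := by simp [ha i j]

variable {a : Fin 4 → ℤ}

theorem mem_parallelogramExponents : a ∈ parallelogramExponents ↔ a 0 + a 3 = a 1 + a 2 := Iff.rfl

theorem mem_cornerExponents : a ∈ cornerExponents ↔ a 0 = 0 ∧ a 3 = a 1 + a 2 := Iff.rfl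

theorem mem_parallelepipedExponents {a : Fin 8 → ℤ} : a ∈ parallelepipedExponents ↔
    a 0 + a 3 = a 1 + a 2 ∧ a 4 + a 7 = a 5 + a 6 ∧ a 0 + a 5 = a 1 + a 4 ∧
      a 0 + a 6 = a 2 + a 4 := Iff.rfl

theorem mem_diagonalExponents {I : Type*} {a : I → ℤ} :
    a ∈ diagonalExponents I ↔ ∀ i j, a i = a j := Iff.rfl

theorem corner_le_parallelogramExponents : cornerExponents ≤ parallelogramExponents := by
  intro a ha
  rw [mem_cornerExponents] at ha
  rw [mem_parallelogramExponents]
  omega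

/-- Isometries of the cube preserve the exponents of parallelepipeds, since these are the
functions that satisfy the parallelogram equation on every square of side one. -/
theorem comp_mem_parallelepipedExponents {a : Fin 8 → ℤ} (ha : a ∈ parallelepipedExponents)
    {σ : Equiv.Perm (Fin 8)} (hσ : IsEuclidean σ) : a ∘ σ ∈ parallelepipedExponents := by
  have hsq : ∀ i j k l : Fin 8, hammingDist (vertex i) (vertex j) = 1 →
      hammingDist (vertex i) (vertex k) = 1 → hammingDist (vertex j) (vertex l) = 1 →
      hammingDist (vertex k) (vertex l) = 1 → hammingDist (vertex i) (vertex l) = 2 →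
      hammingDist (vertex j) (vertex k) = 2 → a i + a l = a j + a k := by
    rw [mem_parallelepipedExponents] at ha
    -- Exponents of a parallelepiped are affine functions of the vertex.
    have hA : ∀ i : Fin 8, a i = a 0 +
        (if vertex i 0 then a 1 - a 0 else 0) + (if vertex i 1 then a 2 - a 0 else 0) +
        (if vertex i 2 then a 4 - a 0 else 0) := by
      intro i
      fin_cases i <;> simp [vertex, Nat.testBit, Nat.shiftRight_eq_div_pow] <;> omega
    -- In a nondegenerate square, each coordinate is constant along one of the two directions of
    -- edges, so its contribution cancels in the parallelogram equation.
    have hc : ∀ i j k l : Fin 8, hammingDist (vertex i) (vertex j) = 1 →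
      hammingDist (vertex i) (vertex k) = 1 → hammingDist (vertex j) (vertex l) = 1 →
      hammingDist (vertex k) (vertex l) = 1 → hammingDist (vertex i) (vertex l) = 2 →
      hammingDist (vertex j) (vertex k) = 2 → ∀ t,
        (vertex i t = vertex j t ∧ vertex k t = vertex l t) ∨
        (vertex i t = vertex k t ∧ vertex j t = vertex l t) := by
      decide +kernel
    intro i j k l h1 h2 h3 h4 h5 h6
    have h := hc i j k l h1 h2 h3 h4 h5 h6
    rw [hA i, hA j, hA k, hA l]
    rcases h 0 with ⟨e1, e2⟩ | ⟨e1, e2⟩ <;> rcases h 1 with ⟨e3, e4⟩ | ⟨e3, e4⟩ <;>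
      rcases h 2 with ⟨e5, e6⟩ | ⟨e5, e6⟩ <;> rw [e1, e2, e3, e4, e5, e6] <;> ring
  have hsq' : ∀ i j k l : Fin 8, hammingDist (vertex i) (vertex j) = 1 →
      hammingDist (vertex i) (vertex k) = 1 → hammingDist (vertex j) (vertex l) = 1 →
      hammingDist (vertex k) (vertex l) = 1 → hammingDist (vertex i) (vertex l) = 2 →
      hammingDist (vertex j) (vertex k) = 2 → a (σ i) + a (σ l) = a (σ j) + a (σ k) := by
    intro i j k l h1 h2 h3 h4 h5 h6
    exact hsq _ _ _ _ (by rw [hσ, h1]) (by rw [hσ, h2]) (by rw [hσ, h3]) (by rw [hσ, h4])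
      (by rw [hσ, h5]) (by rw [hσ, h6])
  refine ⟨hsq' 0 1 2 3 ?_ ?_ ?_ ?_ ?_ ?_, hsq' 4 5 6 7 ?_ ?_ ?_ ?_ ?_ ?_,
    hsq' 0 1 4 5 ?_ ?_ ?_ ?_ ?_ ?_, hsq' 0 2 4 6 ?_ ?_ ?_ ?_ ?_ ?_⟩ <;> decide

end Exponents

/-! ### Parallelograms and parallelepipeds as orbit closures -/

section Cubes

variable {X : Type*} [TopologicalSpace X] {T : X ≃ₜ X}

/-- The base point is arbitrary: constant exponents belong to the group, and by minimality they take
any constant tuple arbitrarily close to any other. -/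
theorem mem_parallelograms_iff (hmin : IsMinimal T) (x : X) {u : Fin 4 → X} :
    u ∈ parallelograms T ↔ Reach T parallelogramExponents (fun _ => x) u := by
  constructor
  · intro hu
    refine closure_minimal ?_
      (isClosed_setOf_reach (T := T) (A := parallelogramExponents) fun _ => x) hu
    rintro _ ⟨y, m, n, rfl⟩
    have h := (hmin.reach_const (A := parallelogramExponents)
      (fun n => by simp [mem_parallelogramExponents]) x y).act_right (a := ![0, m, n, m + n])
      (by simp [mem_parallelogramExponents])
    change Reach T parallelogramExponents _ _
    convert h using 1
    ext i; fin_cases i <;> simp [act]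
  · intro hu
    refine hu.mem_of_isClosed isClosed_closure fun a ha => subset_closure
      ⟨(T ^ a 0) x, a 1 - a 0, a 2 - a 0, ?_⟩
    rw [mem_parallelogramExponents] at ha
    ext i
    fin_cases i <;> simp only [act, ← Homeomorph.mul_apply, ← zpow_add] <;> simp
    congr 2
    omega

theorem mem_parallelepipeds_iff (hmin : IsMinimal T) (x : X) {u : Fin 8 → X} :
    u ∈ parallelepipeds T ↔ Reach T parallelepipedExponents (fun _ => x) u := by
  constructor
  · intro hu
    refine closure_minimal ?_
      (isClosed_setOf_reach (T := T) (A := parallelepipedExponents) fun _ => x) hu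
    rintro _ ⟨y, m, n, p, rfl⟩
    have h := (hmin.reach_const (A := parallelepipedExponents)
      (fun n => by simp [mem_parallelepipedExponents]) x y).act_right
      (a := ![0, m, n, m + n, p, m + p, n + p, m + n + p])
      (by simp [mem_parallelepipedExponents]; omega)
    change Reach T parallelepipedExponents _ _
    convert h using 1
    ext i; fin_cases i <;> simp [act]
  · intro hu
    refine hu.mem_of_isClosed isClosed_closure fun a ha => subset_closure
      ⟨(T ^ a 0) x, a 1 - a 0, a 2 - a 0, a 4 - a 0, ?_⟩
    rw [mem_parallelepipedExponents] at ha
    ext i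
    fin_cases i <;> simp only [act, ← Homeomorph.mul_apply, ← zpow_add] <;> simp <;>
      (congr 2; omega)

theorem mem_parallelograms_of_reach [Nonempty X] (hmin : IsMinimal T) {u v : Fin 4 → X}
    (hu : u ∈ parallelograms T) (h : Reach T parallelogramExponents u v) :
    v ∈ parallelograms T := by
  inhabit X
  exact (mem_parallelograms_iff hmin default).2 (((mem_parallelograms_iff hmin default).1 hu).trans h)

theorem mem_parallelepipeds_of_reach [Nonempty X] (hmin : IsMinimal T) {u v : Fin 8 → X}
    (hu : u ∈ parallelepipeds T) (h : Reach T parallelepipedExponents u v) :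
    v ∈ parallelepipeds T := by
  inhabit X
  exact (mem_parallelepipeds_iff hmin default).2
    (((mem_parallelepipeds_iff hmin default).1 hu).trans h)

theorem parallelograms_comp [Nonempty X] (hmin : IsMinimal T) {u : Fin 4 → X}
    (hu : u ∈ parallelograms T) (f : Fin 4 → Fin 4)
    (hf : ∀ a ∈ parallelogramExponents, a ∘ f ∈ parallelogramExponents) :
    u ∘ f ∈ parallelograms T := by
  inhabit X
  exact (mem_parallelograms_iff hmin default).2
    (((mem_parallelograms_iff hmin default).1 hu).proj f hf)

theorem parallelepipeds_comp [Nonempty X] (hmin : IsMinimal T) {u : Fin 8 → X}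
    (hu : u ∈ parallelepipeds T) (f : Fin 8 → Fin 8)
    (hf : ∀ a ∈ parallelepipedExponents, a ∘ f ∈ parallelepipedExponents) :
    u ∘ f ∈ parallelepipeds T := by
  inhabit X
  exact (mem_parallelepipeds_iff hmin default).2
    (((mem_parallelepipeds_iff hmin default).1 hu).proj f hf)

theorem comp_face_mem_parallelograms [Nonempty X] (hmin : IsMinimal T) {u : Fin 8 → X}
    (hu : u ∈ parallelepipeds T) (f : Fin 6) : u ∘ face f ∈ parallelograms T := by
  inhabit X
  refine (mem_parallelograms_iff hmin default).2
    (((mem_parallelepipeds_iff hmin default).1 hu).proj (face f) fun a ha => ?_)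
  rw [mem_parallelepipedExponents] at ha
  rw [mem_parallelogramExponents]
  fin_cases f <;> simp [face] <;> omega

theorem pair_self_mem_parallelepipeds [Nonempty X] (hmin : IsMinimal T) {u : Fin 4 → X}
    (hu : u ∈ parallelograms T) : pair u u ∈ parallelepipeds T := by
  inhabit X
  have h := ((mem_parallelograms_iff hmin default).1 hu).proj (B := parallelepipedExponents)
    ![0, 1, 2, 3, 0, 1, 2, 3] fun a ha => by
      rw [mem_parallelogramExponents] at ha
      rw [mem_parallelepipedExponents]
      simp; omega
  refine (mem_parallelepipeds_iff hmin default).2 ?_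
  convert h using 1 <;> ext i <;> fin_cases i <;> rfl

end Cubes

/-! ### Transitivity -/

section Distal

variable {X : Type*} [MetricSpace X] [CompactSpace X] [Nonempty X] {T : X ≃ₜ X}

/-- Collapse the second parallelogram to a constant and let the first edge follow the shared one.
The first and the outer parallelogram then coincide, and by distality the move can be reversed on
the outer one. -/
theorem parallelograms_trans (hmin : IsMinimal T) (hdist : IsDistal T) {x₀ x₁ x₂ x₃ x₄ x₅ : X}
    (h : ![x₀, x₁, x₂, x₃] ∈ parallelograms T) (h' : ![x₂, x₃, x₄, x₅] ∈ parallelograms T) :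
    ![x₀, x₁, x₄, x₅] ∈ parallelograms T := by
  inhabit X
  let x : X := default
  let A : AddSubgroup (Fin 6 → ℤ) :=
    { carrier := {a | a 0 + a 3 = a 1 + a 2 ∧ a 2 + a 5 = a 3 + a 4}
      zero_mem' := by simp
      add_mem' := fun {a b} ha hb => by simp only [Set.mem_ofPred_eq, Pi.add_apply] at *; omega
      neg_mem' := fun {a} ha => by simp only [Set.mem_ofPred_eq, Pi.neg_apply] at *; omega }
  have hA : ∀ a, a ∈ A ↔ a 0 + a 3 = a 1 + a 2 ∧ a 2 + a 5 = a 3 + a 4 := fun _ => Iff.rfl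
  obtain ⟨z, hz, hz', -⟩ := (((mem_parallelograms_iff hmin x).1 h').symm hdist).extend (A := A)
    ![some 0, some 1, some 0, some 1, some 2, some 3] (fun b hb => by
      rw [mem_parallelogramExponents] at hb
      simp [hA]; omega) ![x₀, x₁, x₂, x₃, x₄, x₅]
  have e2 : z 2 = x := hz' 2 0 rfl rfl
  have e3 : z 3 = x := hz' 3 1 rfl rfl
  have e4 : z 4 = x := hz' 4 2 rfl rfl
  have e5 : z 5 = x := hz' 5 3 rfl rfl
  have h₁ := hz.proj (B := parallelogramExponents) ![0, 1, 2, 3] fun a ha => by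
    rw [hA] at ha; simp [mem_parallelogramExponents]; omega
  have h₂ := hz.proj (B := parallelogramExponents) ![0, 1, 4, 5] fun a ha => by
    rw [hA] at ha; simp [mem_parallelogramExponents]; omega
  have hzP : z ∘ ![0, 1, 2, 3] ∈ parallelograms T :=
    mem_parallelograms_of_reach hmin (by convert h using 1; ext i; fin_cases i <;> rfl) h₁
  have e : z ∘ ![0, 1, 2, 3] = z ∘ ![0, 1, 4, 5] := by
    ext i; fin_cases i <;> simp [e2, e3, e4, e5]
  rw [e] at hzP
  convert mem_parallelograms_of_reach hmin hzP (h₂.symm hdist) using 1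
  ext i; fin_cases i <;> rfl

/-- The argument is that for parallelograms, with a shared face in place of a shared edge. -/
theorem parallelepipeds_trans (hmin : IsMinimal T) (hdist : IsDistal T) {u v w : Fin 4 → X}
    (h : pair u v ∈ parallelepipeds T) (h' : pair v w ∈ parallelepipeds T) :
    pair u w ∈ parallelepipeds T := by
  inhabit X
  let x : X := default
  let A : AddSubgroup (Fin 12 → ℤ) :=
    { carrier := {a | a 0 + a 3 = a 1 + a 2 ∧ (a 4 + a 7 = a 5 + a 6 ∧ a 0 + a 5 = a 1 + a 4 ∧
        a 0 + a 6 = a 2 + a 4) ∧ (a 8 + a 11 = a 9 + a 10 ∧ a 0 + a 9 = a 1 + a 8 ∧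
        a 0 + a 10 = a 2 + a 8)}
      zero_mem' := by simp
      add_mem' := fun {a b} ha hb => by simp only [Set.mem_ofPred_eq, Pi.add_apply] at *; omega
      neg_mem' := fun {a} ha => by simp only [Set.mem_ofPred_eq, Pi.neg_apply] at *; omega }
  have hA : ∀ a, a ∈ A ↔ a 0 + a 3 = a 1 + a 2 ∧ (a 4 + a 7 = a 5 + a 6 ∧ a 0 + a 5 = a 1 + a 4 ∧
        a 0 + a 6 = a 2 + a 4) ∧ (a 8 + a 11 = a 9 + a 10 ∧ a 0 + a 9 = a 1 + a 8 ∧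
        a 0 + a 10 = a 2 + a 8) := fun _ => Iff.rfl
  obtain ⟨z, hz, hz', -⟩ := (((mem_parallelepipeds_iff hmin x).1 h').symm hdist).extend (A := A)
    ![some 0, some 1, some 2, some 3, some 0, some 1, some 2, some 3, some 4, some 5, some 6,
      some 7] (fun b hb => by
      rw [mem_parallelepipedExponents] at hb
      simp [hA]; omega)
    ![u 0, u 1, u 2, u 3, v 0, v 1, v 2, v 3, w 0, w 1, w 2, w 3]
  have e4 : z 4 = z 8 := (hz' 4 0 rfl rfl).trans (hz' 8 4 rfl rfl).symm
  have e5 : z 5 = z 9 := (hz' 5 1 rfl rfl).trans (hz' 9 5 rfl rfl).symm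
  have e6 : z 6 = z 10 := (hz' 6 2 rfl rfl).trans (hz' 10 6 rfl rfl).symm
  have e7 : z 7 = z 11 := (hz' 7 3 rfl rfl).trans (hz' 11 7 rfl rfl).symm
  have h₁ := hz.proj (B := parallelepipedExponents) ![0, 1, 2, 3, 4, 5, 6, 7] fun a ha => by
    rw [hA] at ha; simp [mem_parallelepipedExponents]; omega
  have h₂ := hz.proj (B := parallelepipedExponents) ![0, 1, 2, 3, 8, 9, 10, 11] fun a ha => by
    rw [hA] at ha; simp [mem_parallelepipedExponents]; omega
  have hzQ : z ∘ ![0, 1, 2, 3, 4, 5, 6, 7] ∈ parallelepipeds T :=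
    mem_parallelepipeds_of_reach hmin (by convert h using 1; ext i; fin_cases i <;> rfl) h₁
  have e : z ∘ ![0, 1, 2, 3, 4, 5, 6, 7] = z ∘ ![0, 1, 2, 3, 8, 9, 10, 11] := by
    ext i; fin_cases i <;> simp [e4, e5, e6, e7]
  rw [e] at hzQ
  convert mem_parallelepipeds_of_reach hmin hzQ (h₂.symm hdist) using 1
  ext i; fin_cases i <;> rfl

end Distal

/-! ### The equivalence relation of corners at a point -/

section Corner

variable {X : Type*} [MetricSpace X] [CompactSpace X] {T : X ≃ₜ X}

theorem reach_corner_self (hmin : IsMinimal T) (x a : X) :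
    Reach T cornerExponents (fun _ => x) ![x, a, x, a] := by
  obtain ⟨z, hz, h₁, h₀⟩ := (hmin.reach_const (A := (⊤ : AddSubgroup (Fin 1 → ℤ)))
    (fun _ => AddSubgroup.mem_top _) x a).extend (A := cornerExponents)
    ![none, some 0, none, some 0] (fun b _ => by simp [mem_cornerExponents]) fun _ => x
  convert hz using 1
  ext i; fin_cases i
  exacts [(h₀ 0 rfl).symm, (h₁ 1 0 rfl rfl).symm, (h₀ 2 rfl).symm, (h₁ 3 0 rfl rfl).symm]

/-- The exponents `(0, n, 0, n)` are those of a corner, so the relation between `a` and `b` is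
invariant under `T × T` and its limits. -/
theorem reach_corner_of_reach {x a b a' b' : X}
    (h : Reach T cornerExponents (fun _ => x) ![x, a, x, b])
    (h' : Reach T (diagonalExponents (Fin 2)) ![a, b] ![a', b']) :
    Reach T cornerExponents (fun _ => x) ![x, a', x, b'] := by
  obtain ⟨z, hz, h₁, h₀⟩ := h'.extend (A := cornerExponents) ![none, some 0, none, some 1]
    (fun b hb => by
      have := mem_diagonalExponents.1 hb 0 1
      simp [mem_cornerExponents, this]) ![x, a, x, b]
  convert h.trans hz using 1
  ext i; fin_cases i
  exacts [(h₀ 0 rfl).symm, (h₁ 1 0 rfl rfl).symm, (h₀ 2 rfl).symm, (h₁ 3 1 rfl rfl).symm]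

/-- Two corners are glued along `b`: with exponents `(0, m, n, m + n)` for the first and `(0, m + n,
p, m + n + p)` for the second, the composite has exponents `(0, m, n + p, m + n + p)`. The seven
coordinates in `A` carry all three, and collapse to `x` in two moves. -/
theorem reach_corner_trans (hdist : IsDistal T) {x a b c : X}
    (h : Reach T cornerExponents (fun _ => x) ![x, a, x, b])
    (h' : Reach T cornerExponents (fun _ => x) ![x, b, x, c]) :
    Reach T cornerExponents (fun _ => x) ![x, a, x, c] := by
  let A : AddSubgroup (Fin 7 → ℤ) :=
    { carrier := {a | a 0 = 0 ∧ a 3 = a 1 + a 2 ∧ a 5 = a 1 + a 2 + a 4 ∧ a 6 = a 2 + a 4}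
      zero_mem' := by simp
      add_mem' := fun {a b} ha hb => by simp only [Set.mem_ofPred_eq, Pi.add_apply] at *; omega
      neg_mem' := fun {a} ha => by simp only [Set.mem_ofPred_eq, Pi.neg_apply] at *; omega }
  have hA : ∀ a, a ∈ A ↔ a 0 = 0 ∧ a 3 = a 1 + a 2 ∧ a 5 = a 1 + a 2 + a 4 ∧ a 6 = a 2 + a 4 :=
    fun _ => Iff.rfl
  obtain ⟨y, hy, hy₁, hy₀⟩ := (h.symm hdist).extend (A := A)
    ![none, some 1, some 2, some 3, none, some 3, some 2]
    (fun b hb => by rw [mem_cornerExponents] at hb; simp [hA]; omega) ![x, a, x, b, x, c, x]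
  have y0 : y 0 = x := hy₀ 0 rfl
  have y1 : y 1 = x := hy₁ 1 1 rfl rfl
  have y2 : y 2 = x := hy₁ 2 2 rfl rfl
  have y3 : y 3 = x := hy₁ 3 3 rfl rfl
  have y4 : y 4 = x := hy₀ 4 rfl
  have y6 : y 6 = x := hy₁ 6 2 rfl rfl
  have hc := hy.proj (B := cornerExponents) ![0, 3, 4, 5] fun a ha => by
    rw [hA] at ha; simp [mem_cornerExponents]; omega
  have hx : Reach T cornerExponents (y ∘ ![0, 3, 4, 5]) fun _ => x := by
    refine (hc.symm hdist).trans ?_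
    convert h'.symm hdist using 1
    ext i; fin_cases i <;> rfl
  obtain ⟨z, hz, hz₁, hz₀⟩ := hx.extend (A := A)
    ![none, some 1, none, some 1, some 2, some 3, some 2]
    (fun b hb => by rw [mem_cornerExponents] at hb; simp [hA]; omega) y
  have hzx : z = fun _ => x := by
    ext i; fin_cases i
    · exact (hz₀ 0 rfl).trans y0
    · exact hz₁ 1 1 rfl (y1.trans y3.symm)
    · exact (hz₀ 2 rfl).trans y2
    · exact hz₁ 3 1 rfl rfl
    · exact hz₁ 4 2 rfl rfl
    · exact hz₁ 5 3 rfl rfl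
    · exact hz₁ 6 2 rfl (y6.trans y4.symm)
  subst hzx
  have := (hy.trans hz).proj (B := cornerExponents) ![0, 1, 6, 5] fun a ha => by
    rw [hA] at ha; simp [mem_cornerExponents]; omega
  convert this.symm hdist using 1 <;> ext i <;> fin_cases i <;> rfl

/-- In the quotient by the relation of the corner at `x`, the limit of `T ^ n a` is determined by
that of `T ^ n x`. -/
theorem reach_corner_of_reach_of_reach (hmin : IsMinimal T) (hdist : IsDistal T)
    {x a v b b' : X} (h : Reach T (diagonalExponents (Fin 2)) ![x, a] ![v, b])
    (h' : Reach T (diagonalExponents (Fin 2)) ![x, a] ![v, b']) :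
    Reach T cornerExponents (fun _ => x) ![x, b, x, b'] := by
  -- Move `v` back to `x`, carrying `b` and `b'` along; invariance of the relation undoes this at
  -- the end.
  obtain ⟨z, hz, hz₁, -⟩ := (hmin.reach_const (A := (⊤ : AddSubgroup (Fin 1 → ℤ)))
    (fun _ => AddSubgroup.mem_top _) v x).extend (A := diagonalExponents (Fin 3))
    ![some 0, some 0, some 0] (fun b _ => by
      rw [mem_diagonalExponents]
      intro i j; fin_cases i <;> fin_cases j <;> rfl) ![v, b, b']
  have z0 : z 0 = x := hz₁ 0 0 rfl rfl
  have hproj : ∀ f : Fin 2 → Fin 3, ∀ a ∈ diagonalExponents (Fin 3),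
      a ∘ f ∈ diagonalExponents (Fin 2) := fun f a ha i j => ha _ _
  have h₁ : Reach T (diagonalExponents (Fin 2)) ![x, a] (z ∘ ![0, 1]) := by
    refine h.trans ?_
    convert hz.proj ![0, 1] (hproj _) using 1
    ext i; fin_cases i <;> rfl
  have h₂ : Reach T (diagonalExponents (Fin 2)) ![x, a] (z ∘ ![0, 2]) := by
    refine h'.trans ?_
    convert hz.proj ![0, 2] (hproj _) using 1
    ext i; fin_cases i <;> rfl
  -- Now `(x, z 1)` reaches `(x, z 2)` diagonally, so the exponents `(0, 0, n, n)` change only the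
  -- last vertex of `![x, z 1, x, z 1]`.
  obtain ⟨y, hy, hy₁, hy₀⟩ := ((h₁.symm hdist).trans h₂).extend (A := cornerExponents)
    ![none, none, some 0, some 1]
    (fun b hb => by
      have := mem_diagonalExponents.1 hb 0 1
      simp [mem_cornerExponents, this]) ![x, z 1, x, z 1]
  have hyz : y = ![x, z 1, x, z 2] := by
    ext i; fin_cases i
    · exact hy₀ 0 rfl
    · exact hy₀ 1 rfl
    · exact (hy₁ 2 0 rfl z0.symm).trans z0
    · exact hy₁ 3 1 rfl rfl
  subst hyz
  refine reach_corner_of_reach ((reach_corner_self hmin x (z 1)).trans hy) ?_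
  convert (hz.symm hdist).proj ![1, 2] (hproj _) using 1 <;> ext i <;> fin_cases i <;> rfl

end Corner

/-! ### Equicontinuity from Baire's theorem -/

section Equicontinuity

variable {X : Type*} [MetricSpace X] [CompactSpace X] {T : X ≃ₜ X}

theorem reach_diagonal_zpow {X : Type*} [TopologicalSpace X] (T : X ≃ₜ X) (x a : X) (n : ℤ) :
    Reach T (diagonalExponents (Fin 2)) ![x, a] ![(T ^ n) x, (T ^ n) a] := by
  convert Reach.of_act (T := T) (A := diagonalExponents (Fin 2)) (a := fun _ => n)
    (fun _ _ => rfl) ![x, a] using 1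
  ext i; fin_cases i <;> rfl

/-- If `T ^ n x` determines `h (T ^ n a)` in a continuous way, for each `a`, then the functions
`h ∘ T ^ n` are equicontinuous: by Baire's theorem the modulus of continuity may be chosen
uniform on an open set of points `a`. -/
theorem exists_pos_forall_abs_sub_le (hmin : IsMinimal T) {h : X → ℝ} (hh : Continuous h)
    {x : X} (hx : ∀ a v b b', Reach T (diagonalExponents (Fin 2)) ![x, a] ![v, b] →
      Reach T (diagonalExponents (Fin 2)) ![x, a] ![v, b'] → h b = h b')
    {ε : ℝ} (hε : 0 < ε) :
    ∃ δ > 0, ∀ a b, dist a b < δ → ∀ n : ℤ, |h ((T ^ n) a) - h ((T ^ n) b)| ≤ 4 * ε := by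
  have hT : ∀ n : ℤ, Continuous fun a => h ((T ^ n) a) := fun n => hh.comp (T ^ n).continuous
  let r : ℕ → ℝ := fun j => 1 / ((j : ℝ) + 1)
  have hr : ∀ j, 0 < r j := fun j => Nat.one_div_pos_of_nat
  let C : ℕ → Set X := fun j => {a | ∀ n m : ℤ, dist ((T ^ n) x) ((T ^ m) x) < r j →
    |h ((T ^ n) a) - h ((T ^ m) a)| ≤ ε}
  have hC : ∀ j, IsClosed (C j) := by
    intro j
    simp only [C, Set.ofPred_forall]
    exact isClosed_iInter fun n => isClosed_iInter fun m => isClosed_iInter fun _ =>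
      isClosed_le ((hT n).sub (hT m)).abs continuous_const
  -- If `a` lay in no `C j`, two subsequences with the same limit `v` of the orbit of `x` would give
  -- limits `b`, `b'` with `h b ≠ h b'`.
  have hU : ⋃ j, C j = Set.univ := by
    by_contra hne
    obtain ⟨a, ha⟩ := (Set.ne_univ_iff_exists_notMem _).1 hne
    have : ∀ j, ∃ n m : ℤ, dist ((T ^ n) x) ((T ^ m) x) < r j ∧
        ε < |h ((T ^ n) a) - h ((T ^ m) a)| := by
      intro j
      by_contra! hcon
      exact ha (Set.mem_iUnion.2 ⟨j, fun n m hnm => hcon n m hnm⟩)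
    choose n m hnm hgt using this
    obtain ⟨⟨⟨v, b⟩, v', b'⟩, -, φ, hφ, hlim⟩ := isCompact_univ.tendsto_subseq
      (x := fun j => (((T ^ n j) x, (T ^ n j) a), ((T ^ m j) x, (T ^ m j) a)))
      fun _ => Set.mem_univ _
    rw [nhds_prod_eq, nhds_prod_eq, nhds_prod_eq] at hlim
    have hv := hlim.fst.fst
    have hb := hlim.fst.snd
    have hv' := hlim.snd.fst
    have hb' := hlim.snd.snd
    simp only [Function.comp_def] at hv hb hv' hb'
    have hvv : v = v' := by
      have h0 : Tendsto (fun i => dist ((T ^ n (φ i)) x) ((T ^ m (φ i)) x)) atTop (𝓝 0) :=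
        squeeze_zero (fun _ => dist_nonneg) (fun i => (hnm (φ i)).le)
          (tendsto_one_div_add_atTop_nhds_zero_nat.comp hφ.tendsto_atTop)
      exact dist_eq_zero.1 (tendsto_nhds_unique (hv.dist hv') h0)
    subst hvv
    have hreach : ∀ (k : ℕ → ℤ) (c : X), Tendsto (fun i => (T ^ k (φ i)) x) atTop (𝓝 v) →
        Tendsto (fun i => (T ^ k (φ i)) a) atTop (𝓝 c) →
        Reach T (diagonalExponents (Fin 2)) ![x, a] ![v, c] := by
      intro k c h₁ h₂
      refine (isClosed_setOf_reach (T := T) (A := diagonalExponents (Fin 2))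
        ![x, a]).mem_of_tendsto (f := fun i => ![(T ^ k (φ i)) x, (T ^ k (φ i)) a]) (b := atTop)
        (tendsto_pi_nhds.2 fun i => ?_) (Eventually.of_forall fun i => reach_diagonal_zpow T x a _)
      fin_cases i
      exacts [h₁, h₂]
    have heq := hx a v b b' (hreach n b hv hb) (hreach m b' hv' hb')
    have hle : ε ≤ |h b - h b'| := ge_of_tendsto
      (((hh.tendsto b).comp hb).sub ((hh.tendsto b').comp hb')).abs
      (Eventually.of_forall fun i => (hgt (φ i)).le)
    rw [heq, sub_self, abs_zero] at hle
    exact absurd hε (not_lt.2 hle)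
  have : Nonempty X := ⟨x⟩
  obtain ⟨j, a₀, ha₀⟩ := nonempty_interior_of_iUnion_of_closed hC hU
  obtain ⟨s, hs⟩ := isCompact_univ.elim_finite_subcover
    (fun n : ℤ => Metric.ball ((T ^ n) x) (r j)) (fun n => Metric.isOpen_ball) (by
      intro y _
      obtain ⟨_, ⟨n, rfl⟩, hn⟩ := Metric.mem_closure_iff.1 (hmin x y) (r j) (hr j)
      exact Set.mem_iUnion.2 ⟨n, hn⟩)
  let U : Set X := interior (C j) ∩ ⋂ n ∈ s, {a | |h ((T ^ n) a) - h ((T ^ n) a₀)| < ε}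
  have hUo : IsOpen U := isOpen_interior.inter (isOpen_biInter_finset fun n _ =>
    isOpen_lt ((hT n).sub continuous_const).abs continuous_const)
  have ha₀U : a₀ ∈ U := ⟨ha₀, by simp [hε]⟩
  have hUU : ∀ a ∈ U, ∀ b ∈ U, ∀ k : ℤ, |h ((T ^ k) a) - h ((T ^ k) b)| ≤ 4 * ε := by
    intro a ha b hb k
    obtain ⟨n, hns, hn⟩ := Set.mem_iUnion₂.1 (hs (Set.mem_univ ((T ^ k) x)))
    -- One `ε` comes from `C j`, replacing `k` by one of finitely many `n`; the other from the
    -- closeness of `c` to `a₀` at those `n`.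
    have key : ∀ c ∈ U, |h ((T ^ k) c) - h ((T ^ n) a₀)| ≤ 2 * ε := by
      intro c hc
      have h₁ := interior_subset hc.1 k n hn
      have h₂ : |h ((T ^ n) c) - h ((T ^ n) a₀)| < ε := Set.mem_iInter₂.1 hc.2 n hns
      have := abs_sub_le (h ((T ^ k) c)) (h ((T ^ n) c)) (h ((T ^ n) a₀))
      linarith
    have h₁ := key a ha
    have h₂ := key b hb
    rw [abs_sub_comm] at h₂
    have := abs_sub_le (h ((T ^ k) a)) (h ((T ^ n) a₀)) (h ((T ^ k) b))
    linarith
  -- By minimality the translates of `U` cover `X`. Nearby points share a translate, and the shift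
  -- is harmless because the bound on `U` holds for all powers.
  obtain ⟨δ, hδ, hcover⟩ := lebesgue_number_lemma_of_metric isCompact_univ
    (c := fun k : ℤ => (T ^ k) ⁻¹' U) (fun k => hUo.preimage (T ^ k).continuous) (by
      intro y _
      obtain ⟨_, hyU, k, rfl⟩ := (hmin y).inter_open_nonempty U hUo ⟨a₀, ha₀U⟩
      exact Set.mem_iUnion.2 ⟨k, hyU⟩)
  refine ⟨δ, hδ, fun a b hab n => ?_⟩
  obtain ⟨k, hk⟩ := hcover a (Set.mem_univ a)
  have := hUU _ (hk (Metric.mem_ball_self hδ)) _ (hk (Metric.mem_ball'.2 hab)) (n - k)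
  simpa only [← Homeomorph.mul_apply, ← zpow_add, sub_add_cancel] using this

end Equicontinuity

/-! ### Parallelograms with a fixed base point -/

section CornerOfParallelogram

variable {X : Type*} [MetricSpace X] [CompactSpace X] {T : X ≃ₜ X}

theorem reach_corner_of_eq (hmin : IsMinimal T) (hdist : IsDistal T) {x y : X}
    (hxy : ![x, x, x, y] ∈ parallelograms T) :
    Reach T cornerExponents (fun _ => x) ![x, x, x, y] := by
  -- Both directions are required, which makes symmetry automatic.
  let s : Setoid X :=
    { r := fun a b => Reach T cornerExponents (fun _ => x) ![x, a, x, b] ∧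
        Reach T cornerExponents (fun _ => x) ![x, b, x, a]
      iseqv :=
        { refl := fun a => ⟨reach_corner_self hmin x a, reach_corner_self hmin x a⟩
          symm := And.symm
          trans := fun h h' => ⟨reach_corner_trans hdist h.1 h'.1,
            reach_corner_trans hdist h'.2 h.2⟩ } }
  have hs : IsClosed {p : X × X | s p.1 p.2} := by
    refine IsClosed.inter
      ((isClosed_setOf_reach (T := T) (A := cornerExponents) fun _ => x).preimage
        (f := fun p : X × X => ![x, p.1, x, p.2]) ?_)
      ((isClosed_setOf_reach (T := T) (A := cornerExponents) fun _ => x).preimage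
        (f := fun p : X × X => ![x, p.2, x, p.1]) ?_) <;>
    · refine continuous_pi fun i => ?_
      fin_cases i <;> simp <;> fun_prop
  suffices s x y from this.1
  by_contra hne
  obtain ⟨h, hh, hinv, hhne⟩ := exists_continuous_invariant_ne s hs hne
  apply hhne
  refine eq_of_abs_sub_le_all fun ε hε => ?_
  -- Two approximations cost `ε / 6` each and equicontinuity costs `4 * (ε / 6)`.
  have hε6 : 0 < ε / 6 := by positivity
  obtain ⟨δ, hδ, hequi⟩ := exists_pos_forall_abs_sub_le hmin hh (x := x)
    (fun a v b b' h₁ h₂ => hinv b b' ⟨reach_corner_of_reach_of_reach hmin hdist h₁ h₂,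
      reach_corner_of_reach_of_reach hmin hdist h₂ h₁⟩) hε6
  have hopen : IsOpen {u : Fin 4 → X | dist (u 0) (u 1) < δ ∧ |h x - h (u 2)| < ε / 6 ∧
      |h (u 3) - h y| < ε / 6} := by
    have h₀ : IsOpen {u : Fin 4 → X | dist (u 0) (u 1) < δ} :=
      isOpen_lt (by fun_prop) continuous_const
    have h₂ : IsOpen {u : Fin 4 → X | |h x - h (u 2)| < ε / 6} :=
      isOpen_lt (by fun_prop) continuous_const
    have h₃ : IsOpen {u : Fin 4 → X | |h (u 3) - h y| < ε / 6} :=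
      isOpen_lt (by fun_prop) continuous_const
    exact h₀.inter (h₂.inter h₃)
  obtain ⟨_, ⟨h₁, h₂, h₃⟩, z, m, n, rfl⟩ := mem_closure_iff.1 hxy _ hopen
    (by simp [hδ, hε])
  have h₄ := hequi _ _ h₁ n
  simp only [Matrix.cons_val] at h₂ h₃ h₄
  rw [← Homeomorph.mul_apply, ← zpow_add, add_comm n m] at h₄
  have h₅ := abs_sub_le (h x) (h ((T ^ n) z)) (h ((T ^ (m + n)) z))
  have h₆ := abs_sub_le (h x) (h ((T ^ (m + n)) z)) (h y)
  linarith

/-- Every parallelogram is a limit of parallelograms with the same base point. -/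
theorem reach_corner_of_mem [Nonempty X] (hmin : IsMinimal T) (hdist : IsDistal T)
    {x₀ x₁ x₂ x₃ : X} (h : ![x₀, x₁, x₂, x₃] ∈ parallelograms T) :
    Reach T cornerExponents (fun _ => x₀) ![x₀, x₁, x₂, x₃] := by
  -- The exponents `(0, n, 0, n)` bring `x₁` to `x₀`; then `(0, 0, n, n)` bring `x₂` to `x₀`.
  obtain ⟨y, hy, hy₁, hy₀⟩ := (hmin.reach_const (A := (⊤ : AddSubgroup (Fin 1 → ℤ)))
    (fun _ => AddSubgroup.mem_top _) x₁ x₀).extend (A := cornerExponents)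
    ![none, some 0, none, some 0] (fun b _ => by simp [mem_cornerExponents]) ![x₀, x₁, x₂, x₃]
  obtain ⟨z, hz, hz₁, hz₀⟩ := (hmin.reach_const (A := (⊤ : AddSubgroup (Fin 1 → ℤ)))
    (fun _ => AddSubgroup.mem_top _) x₂ x₀).extend (A := cornerExponents)
    ![none, none, some 0, some 0] (fun b _ => by simp [mem_cornerExponents]) y
  have hzz : z = ![x₀, x₀, x₀, z 3] := by
    ext i; fin_cases i
    · exact (hz₀ 0 rfl).trans (hy₀ 0 rfl)
    · exact (hz₀ 1 rfl).trans (hy₁ 1 0 rfl rfl)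
    · exact hz₁ 2 0 rfl (hy₀ 2 rfl)
    · rfl
  have hyz := hy.trans hz
  have hzP : z ∈ parallelograms T :=
    mem_parallelograms_of_reach hmin h (hyz.mono corner_le_parallelogramExponents)
  rw [hzz] at hzP hyz
  exact (reach_corner_of_eq hmin hdist hzP).trans (hyz.symm hdist)

end CornerOfParallelogram

/-! ### The closing property -/

section Closing

variable {X : Type*} [MetricSpace X] [CompactSpace X] {T : X ≃ₜ X}

/-- The exponents `(0, m, n, m + n, p, m + p, n + p)`. -/
def punctureExponents : AddSubgroup (Fin 7 → ℤ) where
  carrier := {a | a 0 = 0 ∧ a 3 = a 1 + a 2 ∧ a 5 = a 1 + a 4 ∧ a 6 = a 2 + a 4}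
  zero_mem' := by simp
  add_mem' {a b} ha hb := by simp only [Set.mem_ofPred_eq, Pi.add_apply] at *; omega
  neg_mem' {a} ha := by simp only [Set.mem_ofPred_eq, Pi.neg_apply] at *; omega

theorem mem_punctureExponents {a : Fin 7 → ℤ} : a ∈ punctureExponents ↔
    a 0 = 0 ∧ a 3 = a 1 + a 2 ∧ a 5 = a 1 + a 4 ∧ a 6 = a 2 + a 4 := Iff.rfl

theorem parallelograms_closing (hmin : IsMinimal T) (x₀ x₁ x₂ : X) :
    ∃ x₃, ![x₀, x₁, x₂, x₃] ∈ parallelograms T := by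
  obtain ⟨z, hz, hz₁, hz₀⟩ := (hmin.reach_const (A := (⊤ : AddSubgroup (Fin 1 → ℤ)))
    (fun _ => AddSubgroup.mem_top _) x₀ x₂).extend (A := cornerExponents)
    ![none, none, some 0, some 0] (fun b _ => by simp [mem_cornerExponents]) ![x₀, x₁, x₀, x₁]
  have hzz : z = ![x₀, x₁, x₂, z 3] := by
    ext i; fin_cases i
    exacts [hz₀ 0 rfl, hz₀ 1 rfl, hz₁ 2 0 rfl rfl, rfl]
  refine ⟨z 3, ?_⟩
  rw [← hzz, mem_parallelograms_iff hmin x₀]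
  exact ((reach_corner_self hmin x₀ x₁).trans hz).mono corner_le_parallelogramExponents

/-- Three parallelograms with a common vertex, pairwise sharing an edge, are simultaneously
limits of parallelograms at that vertex. -/
theorem reach_puncture [Nonempty X] (hmin : IsMinimal T) (hdist : IsDistal T) {x₀ x₁ x₂ x₃ x₄ x₅ x₆ : X}
    (h₁ : ![x₀, x₁, x₂, x₃] ∈ parallelograms T) (h₂ : ![x₀, x₁, x₄, x₅] ∈ parallelograms T)
    (h₃ : ![x₀, x₂, x₄, x₆] ∈ parallelograms T) :
    Reach T punctureExponents (fun _ => x₀) ![x₀, x₁, x₂, x₃, x₄, x₅, x₆] := by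
  have hproj₂ : ∀ a ∈ punctureExponents, a ∘ ![0, 1, 4, 5] ∈ cornerExponents := fun a ha => by
    rw [mem_punctureExponents] at ha; simp [mem_cornerExponents]; omega
  have hproj₃ : ∀ a ∈ punctureExponents, a ∘ ![0, 2, 4, 6] ∈ cornerExponents := fun a ha => by
    rw [mem_punctureExponents] at ha; simp [mem_cornerExponents]; omega
  -- Collapse the first parallelogram with the third parameter zero; the next move uses that
  -- parameter alone to bring `x₄` to `x₀`.
  obtain ⟨y, hy, hy₁, hy₀⟩ := ((reach_corner_of_mem hmin hdist h₁).symm hdist).extend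
    (A := punctureExponents) ![none, some 1, some 2, some 3, none, some 1, some 2]
    (fun b hb => by rw [mem_cornerExponents] at hb; simp [mem_punctureExponents]; omega)
    ![x₀, x₁, x₂, x₃, x₄, x₅, x₆]
  obtain ⟨z, hz, hz₁, hz₀⟩ := (hmin.reach_const (A := (⊤ : AddSubgroup (Fin 1 → ℤ)))
    (fun _ => AddSubgroup.mem_top _) x₄ x₀).extend (A := punctureExponents)
    ![none, none, none, none, some 0, some 0, some 0]
    (fun b _ => by simp [mem_punctureExponents]) y
  have z0 : z 0 = x₀ := (hz₀ 0 rfl).trans (hy₀ 0 rfl)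
  have z1 : z 1 = x₀ := (hz₀ 1 rfl).trans (hy₁ 1 1 rfl rfl)
  have z2 : z 2 = x₀ := (hz₀ 2 rfl).trans (hy₁ 2 2 rfl rfl)
  have z3 : z 3 = x₀ := (hz₀ 3 rfl).trans (hy₁ 3 3 rfl rfl)
  have z4 : z 4 = x₀ := hz₁ 4 0 rfl (hy₀ 4 rfl)
  have hyz := hy.trans hz
  have c₂ : Reach T cornerExponents (z ∘ ![0, 1, 4, 5]) fun _ => x₀ := by
    refine ((hyz.proj _ hproj₂).symm hdist).trans ?_
    convert (reach_corner_of_mem hmin hdist h₂).symm hdist using 1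
    ext i; fin_cases i <;> rfl
  -- Exponents `(0, m, 0, m, p, m + p, p)`: vertex `3` starts at `x₀` and moves like vertex `1`, so
  -- it returns to `x₀` with it. The last collapse, with `m = 0`, works likewise.
  obtain ⟨w, hw, hw₁, hw₀⟩ := c₂.extend (A := punctureExponents)
    ![none, some 1, none, some 1, some 2, some 3, some 2]
    (fun b hb => by rw [mem_cornerExponents] at hb; simp [mem_punctureExponents]; omega) z
  have w0 : w 0 = x₀ := (hw₀ 0 rfl).trans z0
  have w1 : w 1 = x₀ := hw₁ 1 1 rfl rfl
  have w2 : w 2 = x₀ := (hw₀ 2 rfl).trans z2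
  have w3 : w 3 = x₀ := hw₁ 3 1 rfl (z3.trans z1.symm)
  have w4 : w 4 = x₀ := hw₁ 4 2 rfl rfl
  have w5 : w 5 = x₀ := hw₁ 5 3 rfl rfl
  have hyw := hyz.trans hw
  have c₃ : Reach T cornerExponents (w ∘ ![0, 2, 4, 6]) fun _ => x₀ := by
    refine ((hyw.proj _ hproj₃).symm hdist).trans ?_
    convert (reach_corner_of_mem hmin hdist h₃).symm hdist using 1
    ext i; fin_cases i <;> rfl
  obtain ⟨v, hv, hv₁, hv₀⟩ := c₃.extend (A := punctureExponents)
    ![none, none, some 1, some 1, some 2, some 2, some 3]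
    (fun b hb => by rw [mem_cornerExponents] at hb; simp [mem_punctureExponents]; omega) w
  have hvx : v = fun _ => x₀ := by
    ext i; fin_cases i
    · exact (hv₀ 0 rfl).trans w0
    · exact (hv₀ 1 rfl).trans w1
    · exact hv₁ 2 1 rfl rfl
    · exact hv₁ 3 1 rfl (w3.trans w2.symm)
    · exact hv₁ 4 2 rfl rfl
    · exact hv₁ 5 2 rfl (w5.trans w4.symm)
    · exact hv₁ 6 3 rfl rfl
  subst hvx
  exact (hyw.trans hv).symm hdist

theorem exists_seq_of_mem_parallelograms [Nonempty X] (hmin : IsMinimal T) (hdist : IsDistal T)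
    {x₀ x₁ x₂ x₃ x₄ x₅ x₆ : X}
    (h₁ : ![x₀, x₁, x₂, x₃] ∈ parallelograms T) (h₂ : ![x₀, x₁, x₄, x₅] ∈ parallelograms T)
    (h₃ : ![x₀, x₂, x₄, x₆] ∈ parallelograms T) :
    ∃ m n p : ℕ → ℤ,
      Tendsto (fun i => (T ^ m i) x₀) atTop (𝓝 x₁) ∧
      Tendsto (fun i => (T ^ n i) x₀) atTop (𝓝 x₂) ∧
      Tendsto (fun i => (T ^ (m i + n i)) x₀) atTop (𝓝 x₃) ∧
      Tendsto (fun i => (T ^ p i) x₀) atTop (𝓝 x₄) ∧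
      Tendsto (fun i => (T ^ (m i + p i)) x₀) atTop (𝓝 x₅) ∧
      Tendsto (fun i => (T ^ (n i + p i)) x₀) atTop (𝓝 x₆) := by
  obtain ⟨u, hu, hlim⟩ := mem_closure_iff_seq_limit.1 (reach_puncture hmin hdist h₁ h₂ h₃)
  choose a ha hau using hu
  have hlim' : ∀ j, Tendsto (fun i => (T ^ a i j) x₀) atTop
      (𝓝 (![x₀, x₁, x₂, x₃, x₄, x₅, x₆] j)) := by
    intro j
    have := tendsto_pi_nhds.1 hlim j
    simp only [← hau] at this
    exact this
  have ha' : ∀ i, a i 3 = a i 1 + a i 2 ∧ a i 5 = a i 1 + a i 4 ∧ a i 6 = a i 2 + a i 4 :=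
    fun i => (mem_punctureExponents.1 (ha i)).2
  refine ⟨fun i => a i 1, fun i => a i 2, fun i => a i 4, hlim' 1, hlim' 2, ?_, hlim' 4, ?_, ?_⟩
  · simp only [← (ha' _).1]
    exact hlim' 3
  · simp only [← (ha' _).2.1]
    exact hlim' 5
  · simp only [← (ha' _).2.2]
    exact hlim' 6

theorem exists_mem_parallelepipeds_of_tendsto {x₀ x₁ x₂ x₃ x₄ x₅ x₆ : X} {m n p : ℕ → ℤ}
    (h₁ : Tendsto (fun i => (T ^ m i) x₀) atTop (𝓝 x₁))
    (h₂ : Tendsto (fun i => (T ^ n i) x₀) atTop (𝓝 x₂))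
    (h₃ : Tendsto (fun i => (T ^ (m i + n i)) x₀) atTop (𝓝 x₃))
    (h₄ : Tendsto (fun i => (T ^ p i) x₀) atTop (𝓝 x₄))
    (h₅ : Tendsto (fun i => (T ^ (m i + p i)) x₀) atTop (𝓝 x₅))
    (h₆ : Tendsto (fun i => (T ^ (n i + p i)) x₀) atTop (𝓝 x₆)) :
    ∃ x₇ : X, ![x₀, x₁, x₂, x₃, x₄, x₅, x₆, x₇] ∈ parallelepipeds T := by
  obtain ⟨x₇, -, φ, hφ, h₇⟩ := isCompact_univ.tendsto_subseq
    (x := fun i => (T ^ (m i + n i + p i)) x₀) fun _ => Set.mem_univ _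
  refine ⟨x₇, isClosed_closure.mem_of_tendsto (b := atTop)
    (f := fun i => ![x₀, (T ^ m (φ i)) x₀, (T ^ n (φ i)) x₀, (T ^ (m (φ i) + n (φ i))) x₀,
      (T ^ p (φ i)) x₀, (T ^ (m (φ i) + p (φ i))) x₀, (T ^ (n (φ i) + p (φ i))) x₀,
      (T ^ (m (φ i) + n (φ i) + p (φ i))) x₀])
    (tendsto_pi_nhds.2 fun j => ?_)
    (Eventually.of_forall fun i => subset_closure ⟨x₀, m (φ i), n (φ i), p (φ i), rfl⟩)⟩
  have hφ' := hφ.tendsto_atTop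
  fin_cases j
  exacts [tendsto_const_nhds, h₁.comp hφ', h₂.comp hφ', h₃.comp hφ', h₄.comp hφ', h₅.comp hφ',
    h₆.comp hφ', h₇]

theorem isParallelogramStructure_parallelograms [Nonempty X] (hmin : IsMinimal T) (hdist : IsDistal T) :
    IsParallelogramStructure (parallelograms T) where
  equivalence :=
    { refl := fun a => by
        have := (mem_parallelograms_iff hmin a.1).2
          ((reach_corner_self hmin a.1 a.2).mono corner_le_parallelogramExponents)
        exact this
      symm := fun {a b} h => by
        convert parallelograms_comp hmin h ![2, 3, 0, 1] fun a ha => by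
          rw [mem_parallelogramExponents] at *; simp; omega
        ext i; fin_cases i <;> rfl
      trans := fun h h' => parallelograms_trans hmin hdist h h' }
  symmetry x₀ x₁ x₂ x₃ h := by
    convert parallelograms_comp hmin h ![0, 2, 1, 3] fun a ha => by
      rw [mem_parallelogramExponents] at *; simp; omega
    ext i; fin_cases i <;> rfl
  closing := parallelograms_closing hmin

theorem isParallelepipedStructure [Nonempty X] (hmin : IsMinimal T) (hdist : IsDistal T) :
    IsParallelepipedStructure (parallelograms T) (parallelepipeds T) where
  parallelogram := isParallelogramStructure_parallelograms hmin hdist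
  face_mem _ hx f := comp_face_mem_parallelograms hmin hx f
  symmetry _ hx σ hσ :=
    parallelepipeds_comp hmin hx σ fun _ ha => comp_mem_parallelepipedExponents ha hσ
  equivalence :=
    { refl := fun u => pair_self_mem_parallelepipeds hmin u.2
      symm := fun {u v} h => by
        convert parallelepipeds_comp hmin h ![4, 5, 6, 7, 0, 1, 2, 3] fun a ha => by
          rw [mem_parallelepipedExponents] at *; simp; omega
        ext i; fin_cases i <;> rfl
      trans := fun h h' => parallelepipeds_trans hmin hdist h h' }
  closing _ _ _ _ _ _ _ h₁ h₂ h₃ := by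
    obtain ⟨m, n, p, l₁, l₂, l₃, l₄, l₅, l₆⟩ :=
      exists_seq_of_mem_parallelograms hmin hdist h₁ h₂ h₃
    exact exists_mem_parallelepipeds_of_tendsto l₁ l₂ l₃ l₄ l₅ l₆

end Closing

end DynPara

theorem mainTheorem5 {X : Type*} [MetricSpace X] [CompactSpace X] [Nonempty X]
    (T : X ≃ₜ X) (hmin : DynPara.IsMinimal T) (hdist : DynPara.IsDistal T) :
    IsClosed (DynPara.parallelograms T) ∧ IsClosed (DynPara.parallelepipeds T) ∧
    DynPara.IsParallelepipedStructure (DynPara.parallelograms T) (DynPara.parallelepipeds T) ∧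
    (∀ u ∈ DynPara.parallelograms T, ∀ v ∈ DynPara.parallelograms T,
      ∀ w ∈ DynPara.parallelograms T,
        DynPara.pair u v ∈ DynPara.parallelepipeds T →
        DynPara.pair v w ∈ DynPara.parallelepipeds T →
        DynPara.pair u w ∈ DynPara.parallelepipeds T) ∧
    ∀ x₀ x₁ x₂ x₃ x₄ x₅ x₆ : X,
      List.TFAE [
        ![x₀, x₁, x₂, x₃] ∈ DynPara.parallelograms T ∧
          ![x₀, x₁, x₄, x₅] ∈ DynPara.parallelograms T ∧
          ![x₀, x₂, x₄, x₆] ∈ DynPara.parallelograms T,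
        ∃ x₇ : X, ![x₀, x₁, x₂, x₃, x₄, x₅, x₆, x₇] ∈ DynPara.parallelepipeds T,
        ∃ m n p : ℕ → ℤ,
          Tendsto (fun i => (T ^ m i) x₀) atTop (𝓝 x₁) ∧
          Tendsto (fun i => (T ^ n i) x₀) atTop (𝓝 x₂) ∧
          Tendsto (fun i => (T ^ (m i + n i)) x₀) atTop (𝓝 x₃) ∧
          Tendsto (fun i => (T ^ p i) x₀) atTop (𝓝 x₄) ∧
          Tendsto (fun i => (T ^ (m i + p i)) x₀) atTop (𝓝 x₅) ∧
          Tendsto (fun i => (T ^ (n i + p i)) x₀) atTop (𝓝 x₆)] := by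
  refine ⟨isClosed_closure, isClosed_closure, DynPara.isParallelepipedStructure hmin hdist,
    fun u _ v _ w _ h h' => DynPara.parallelepipeds_trans hmin hdist h h', ?_⟩
  intro x₀ x₁ x₂ x₃ x₄ x₅ x₆
  tfae_have 1 → 3 := fun ⟨h₁, h₂, h₃⟩ =>
    DynPara.exists_seq_of_mem_parallelograms hmin hdist h₁ h₂ h₃
  tfae_have 3 → 2 := fun ⟨m, n, p, l₁, l₂, l₃, l₄, l₅, l₆⟩ =>
    DynPara.exists_mem_parallelepipeds_of_tendsto l₁ l₂ l₃ l₄ l₅ l₆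
  tfae_have 2 → 1 := by
    rintro ⟨x₇, h⟩
    have hface := DynPara.comp_face_mem_parallelograms hmin h
    refine ⟨?_, ?_, ?_⟩
    · convert hface 0 using 1
      ext i; fin_cases i <;> rfl
    · convert hface 2 using 1
      ext i; fin_cases i <;> rfl
    · convert hface 4 using 1
      ext i; fin_cases i <;> rfl
  tfae_finish
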